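/- Let $\mathcal H$ be a finite-dimensional complex Hilbert space, with scalar product linear in the second argument, and let $\vartheta$ be an antilinear operator on $\mathcal H$. Its Hermitian adjoint $\vartheta^\dagger$ is the antilinear operator determined by $\langle\phi_1,\vartheta^\dagger\phi_2\rangle=\langle\phi_2,\vartheta\phi_1\rangle$ for all $\phi_1,\phi_2\in\mathcal H$. A subspace $W$ is $\vartheta$-invariant if $\vartheta W\subseteq W$; it is minimal $\vartheta$-invariant if moreover $W\neq\{0\}$ and the only $\vartheta$-invariant subspaces contained in $W$ are $\{0\}$ and $W$. For $z\in\mathbb C$ put $\mathcal H_{\pm z}=\{\phi\in\mathcal H : \vartheta^2\phi=z^2\phi\}$. **Theorem (Wigner; Herbut–Vujičić).** Suppose that $\vartheta$ is normal, i.e. $\vartheta^\dagger\vartheta=\vartheta\vartheta^\dagger$. Then: 1. Every $\vartheta$-invariant subspace is $\vartheta^\dagger$-invariant. 2. $\mathcal H$ is an orthogonal sum of finitely many minimal $\vartheta$-invariant subspaces. 3. Every minimal $\vartheta$-invariant subspace $W$ is of one of the following two kinds: - either $\dim W=1$, and $W$ is spanned by an eigenvector $\phi\neq0$ with $\vartheta\phi=z\phi$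 for some $z\in\mathbb C$ with $z=z^*$, and $W\subseteq\mathcal H_{\pm z}$; - or $\dim W=2$, and there are $z\in\mathbb C$ with $z\neq z^*$ and an orthonormal basis $\phi',\phi''$ of $W$ such that $\vartheta\phi'=z^*\phi''$ and $\vartheta\phi''=z\phi'$, and $W\subseteq\mathcal H_{\pm z}+\mathcal H_{\pm z^*}$ (which is just $\mathcal H_{\pm z}$ when $z^2$ is real). -/

import Mathlib

open scoped ComplexConjugate InnerProductSpace

noncomputable section

namespace AntilinearOp

variable {H : Type*} [NormedAddCommGroup H] [InnerProductSpace ℂ H]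

/-- For an antilinear `ϑ` and a vector `y`, the linear functional `x ↦ ⟪ϑ x, y⟫`. -/
def pairing (ϑ : H →ₗ⋆[ℂ] H) (y : H) : H →ₗ[ℂ] ℂ where
  toFun x := ⟪ϑ x, y⟫_ℂ
  map_add' a b := by simp
  map_smul' c a := by simp [mul_comm]

/-- The Hermitian adjoint of an antilinear operator on a finite-dimensional Hilbert space,
obtained from the Riesz representation of `x ↦ ⟪ϑ x, y⟫`. It is characterised by
`inner_adjoint` below. -/
def adjoint [FiniteDimensional ℂ H] (ϑ : H →ₗ⋆[ℂ] H) : H →ₗ⋆[ℂ] H :=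
  haveI : CompleteSpace H := FiniteDimensional.complete ℂ H
  { toFun := fun y => (InnerProductSpace.toDual ℂ H).symm
      (LinearMap.toContinuousLinearMap (pairing ϑ y))
    map_add' := fun a b => by
      refine ext_inner_right ℂ fun x => ?_
      simp [inner_add_left, pairing, InnerProductSpace.toDual_symm_apply]
    map_smul' := fun c a => by
      refine ext_inner_right ℂ fun x => ?_
      simp [inner_smul_left, pairing, InnerProductSpace.toDual_symm_apply] }

/-- The defining relation `⟪φ₁, ϑ† φ₂⟫ = ⟪φ₂, ϑ φ₁⟫` of the antilinear Hermitian adjoint. -/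
theorem inner_adjoint [FiniteDimensional ℂ H] (ϑ : H →ₗ⋆[ℂ] H) (φ₁ φ₂ : H) :
    ⟪φ₁, adjoint ϑ φ₂⟫_ℂ = ⟪φ₂, ϑ φ₁⟫_ℂ := by
  have : CompleteSpace H := FiniteDimensional.complete ℂ H
  rw [← inner_conj_symm, ← inner_conj_symm φ₂ (ϑ φ₁)]
  congr 1
  simp [adjoint, pairing, InnerProductSpace.toDual_symm_apply]

/-- The defining relation determines the adjoint. -/
theorem eq_adjoint [FiniteDimensional ℂ H] (ϑ η : H →ₗ⋆[ℂ] H)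
    (h : ∀ φ₁ φ₂ : H, ⟪φ₁, η φ₂⟫_ℂ = ⟪φ₂, ϑ φ₁⟫_ℂ) : η = adjoint ϑ := by
  ext y
  refine ext_inner_left ℂ fun x => ?_
  rw [h, inner_adjoint]

/-- An antilinear operator is normal if it commutes with its Hermitian adjoint. -/
def IsNormal [FiniteDimensional ℂ H] (ϑ : H →ₗ⋆[ℂ] H) : Prop :=
  ∀ x : H, adjoint ϑ (ϑ x) = ϑ (adjoint ϑ x)

/-- A subspace `W` is `ϑ`-invariant if `ϑ W ⊆ W`. -/
def IsInvariant (ϑ : H →ₗ⋆[ℂ] H) (W : Submodule ℂ H) : Prop :=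
  ∀ x ∈ W, ϑ x ∈ W

/-- A minimal invariant subspace: nonzero, invariant, and with no invariant subspaces other than
zero and itself. -/
def IsMinimalInvariant (ϑ : H →ₗ⋆[ℂ] H) (W : Submodule ℂ H) : Prop :=
  W ≠ ⊥ ∧ IsInvariant ϑ W ∧
    ∀ V : Submodule ℂ H, IsInvariant ϑ V → V ≤ W → V = ⊥ ∨ V = W

/-- The subspace `{φ | ϑ² φ = z² φ}`, denoted `H_{±z}`. -/
def sqEigenspace (ϑ : H →ₗ⋆[ℂ] H) (z : ℂ) : Submodule ℂ H where
  carrier := {φ | ϑ (ϑ φ) = z ^ 2 • φ}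
  zero_mem' := by simp
  add_mem' {a b} ha hb := by
    simp only [Set.mem_ofPred_eq] at ha hb ⊢
    rw [map_add, map_add, ha, hb, smul_add]
  smul_mem' c a ha := by
    simp only [Set.mem_ofPred_eq] at ha ⊢
    rw [map_smulₛₗ, map_smulₛₗ, ha, Complex.conj_conj, smul_comm]

end AntilinearOp

end

namespace AntilinearOp

variable {H : Type*} [NormedAddCommGroup H] [InnerProductSpace ℂ H] {ϑ : H →ₗ⋆[ℂ] H}

/-! Normality gives `‖ϑ† x‖ = ‖ϑ x‖`, and in finite dimension this makes every invariant subspace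
invariant under `ϑ†`. Orthogonal complements are then invariant too, so minimal invariant subspaces
can be split off one at a time.

For the classification, `ϑ²` is complex linear and has an eigenvector `x` in `W`, with eigenvalue
written `z²`. For real `z`, either `ϑ x + z x` or `x` itself is an eigenvector of `ϑ`. Otherwise `ϑ`
exchanges `x` and `w = ϑ x / z*` up to scalars, and normality forces `x` and `w` to be orthogonal
and of equal norm. Minimality identifies `W` with the span found. -/

theorem IsInvariant.inf {V W : Submodule ℂ H} (hV : IsInvariant ϑ V) (hW : IsInvariant ϑ W) :
    IsInvariant ϑ (V ⊓ W) :=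
  fun x hx => ⟨hV x hx.1, hW x hx.2⟩

theorem isInvariant_span {s : Set H} (h : ∀ x ∈ s, ϑ x ∈ Submodule.span ℂ s) :
    IsInvariant ϑ (Submodule.span ℂ s) :=
  fun _ hx => (Submodule.span_le (p := (Submodule.span ℂ s).comap ϑ)).mpr h hx

theorem IsMinimalInvariant.eq_of_mem {W V : Submodule ℂ H} (hW : IsMinimalInvariant ϑ W)
    (hV : IsInvariant ϑ V) (hVW : V ≤ W) {x : H} (hx : x ∈ V) (hx0 : x ≠ 0) : W = V :=
  ((hW.2.2 V hV hVW).resolve_left fun h => hx0 ((Submodule.eq_bot_iff V).mp h x hx)).symm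

theorem IsMinimalInvariant.of_eigenvector {W : Submodule ℂ H} (hW : IsMinimalInvariant ϑ W)
    {z : ℂ} {φ : H} (hz : z = conj z) (hφW : φ ∈ W) (hφ : φ ≠ 0) (h : ϑ φ = z • φ) :
    Module.finrank ℂ W = 1 ∧ ∃ (z : ℂ) (φ : H), z = conj z ∧ φ ≠ 0 ∧ ϑ φ = z • φ ∧
      W = Submodule.span ℂ {φ} ∧ W ≤ sqEigenspace ϑ z := by
  have hinv : IsInvariant ϑ (Submodule.span ℂ {φ}) := isInvariant_span fun x hx => by
    obtain rfl := hx
    exact h ▸ Submodule.smul_mem _ _ (Submodule.mem_span_singleton_self _)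
  obtain rfl := hW.eq_of_mem hinv (by simpa using hφW) (Submodule.mem_span_singleton_self φ) hφ
  refine ⟨finrank_span_singleton hφ, z, φ, hz, hφ, h, rfl, ?_⟩
  rw [Submodule.span_singleton_le_iff_mem]
  change ϑ (ϑ φ) = z ^ 2 • φ
  rw [h, map_smulₛₗ, h, ← hz, smul_smul, sq]

variable [FiniteDimensional ℂ H]

theorem norm_adjoint_apply (hϑ : IsNormal ϑ) (x : H) : ‖adjoint ϑ x‖ = ‖ϑ x‖ := by
  have h : ⟪adjoint ϑ x, adjoint ϑ x⟫_ℂ = ⟪ϑ x, ϑ x⟫_ℂ := by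
    rw [inner_adjoint, ← hϑ, inner_adjoint]
  rw [inner_self_eq_norm_sq_to_K, inner_self_eq_norm_sq_to_K] at h
  have h' : ‖adjoint ϑ x‖ ^ 2 = ‖ϑ x‖ ^ 2 := by exact_mod_cast h
  exact (sq_eq_sq₀ (norm_nonneg _) (norm_nonneg _)).mp h'

/-- An invariant subspace of a normal antilinear operator is invariant under the adjoint: compare
the Hilbert–Schmidt norms of `ϑ` and `adjoint ϑ` restricted to the subspace. -/
theorem IsInvariant.adjoint (hϑ : IsNormal ϑ) {W : Submodule ℂ H} (hW : IsInvariant ϑ W) :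
    IsInvariant (adjoint ϑ) W := by
  let b := stdOrthonormalBasis ℂ W
  let P : H → W := W.orthogonalProjectionOnto
  have hb (y : H) : ‖P y‖ ^ 2 = ∑ j, ‖⟪(b j : H), y⟫_ℂ‖ ^ 2 := by
    rw [← b.sum_sq_norm_inner_right (P y)]
    refine Finset.sum_congr rfl fun j _ => ?_
    rw [← Submodule.inner_orthogonalProjectionOnto_eq_of_mem_left (b j) y]
  have hϑP (i) : ‖ϑ (b i)‖ = ‖P (ϑ (b i))‖ := by
    have := Submodule.starProjection_eq_self_iff.mpr (hW _ (b i).2)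
    rw [Submodule.starProjection_apply] at this
    exact (congrArg norm this).symm
  have hsum : ∑ i, ‖P (AntilinearOp.adjoint ϑ (b i))‖ ^ 2
      = ∑ i, ‖AntilinearOp.adjoint ϑ (b i)‖ ^ 2 := by
    -- Both sides become double sums of `|⟪b i, ϑ (b j)⟫|²`, differing only in the order of
    -- summation.
    simp_rw [norm_adjoint_apply hϑ, hϑP, hb, inner_adjoint]
    exact Finset.sum_comm
  have hle (y : H) : ‖P y‖ ^ 2 ≤ ‖y‖ ^ 2 := by
    gcongr
    exact W.norm_orthogonalProjectionOnto_apply_le y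
  have hmem (i) : AntilinearOp.adjoint ϑ (b i) ∈ W := by
    -- Projection shortens each term, so equal sums force equality term by term.
    have h := (Finset.sum_eq_sum_iff_of_le fun i _ =>
      hle (AntilinearOp.adjoint ϑ (b i))).mp hsum i (Finset.mem_univ i)
    refine W.mem_iff_norm_starProjection _ |>.mpr ?_
    rw [Submodule.starProjection_apply]
    exact (sq_eq_sq₀ (norm_nonneg _) (norm_nonneg _)).mp h
  intro x hx
  have hx' : x = ∑ i, b.repr ⟨x, hx⟩ i • (b i : H) := by
    have := congrArg (Subtype.val) (b.sum_repr ⟨x, hx⟩)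
    simpa using this.symm
  rw [hx', map_sum]
  refine W.sum_mem fun i _ => ?_
  rw [map_smulₛₗ]
  exact W.smul_mem _ (hmem i)

theorem IsInvariant.orthogonal (hϑ : IsNormal ϑ) {W : Submodule ℂ H} (hW : IsInvariant ϑ W) :
    IsInvariant ϑ Wᗮ := by
  intro x hx
  rw [Submodule.mem_orthogonal] at hx ⊢
  intro w hw
  rw [← inner_adjoint, ← inner_conj_symm, hx _ (hW.adjoint hϑ w hw), map_zero]

theorem IsInvariant.exists_minimal_le {V : Submodule ℂ H} (hV : IsInvariant ϑ V) (h0 : V ≠ ⊥) :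
    ∃ W ≤ V, IsMinimalInvariant ϑ W := by
  obtain ⟨W, ⟨hW0, hW, hWV⟩, hmin⟩ := WellFounded.has_min (wellFounded_lt (α := Submodule ℂ H))
    {W | W ≠ ⊥ ∧ IsInvariant ϑ W ∧ W ≤ V} ⟨V, h0, hV, le_rfl⟩
  refine ⟨W, hWV, hW0, hW, fun U hU hUW => ?_⟩
  by_contra! h
  exact hmin U ⟨h.1, hU, hUW.trans hWV⟩ (lt_of_le_of_ne hUW h.2)

theorem IsInvariant.exists_orthogonal_decomposition (hϑ : IsNormal ϑ) (V : Submodule ℂ H)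
    (hV : IsInvariant ϑ V) :
    ∃ (n : ℕ) (W : Fin n → Submodule ℂ H), (∀ i, IsMinimalInvariant ϑ (W i)) ∧
      (∀ i j, i ≠ j → W i ⟂ W j) ∧ (⨆ i, W i) = V := by
  induction V using (wellFounded_lt (α := Submodule ℂ H)).induction with
  | _ V ih =>
  by_cases h0 : V = ⊥
  · exact ⟨0, Fin.elim0, fun i => i.elim0, fun i => i.elim0, by simp [h0]⟩
  obtain ⟨U, hUV, hU⟩ := hV.exists_minimal_le h0
  have hlt : Uᗮ ⊓ V < V := by
    refine lt_of_le_of_ne inf_le_right fun h => hU.1 ?_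
    have hle : U ≤ Uᗮ := hUV.trans (inf_eq_right.mp h)
    rw [eq_bot_iff, ← U.inf_orthogonal_eq_bot]
    exact le_inf le_rfl hle
  obtain ⟨n, W, hmin, hort, hsup⟩ := ih _ hlt ((hU.2.1.orthogonal hϑ).inf hV)
  have hUW (i) : U ⟂ W i :=
    Submodule.IsOrtho.symm ((le_iSup W i).trans (hsup.trans_le inf_le_left))
  refine ⟨n + 1, Fin.cons U W, Fin.cases hU hmin, ?_, ?_⟩
  · refine Fin.cases (Fin.cases (fun h => absurd rfl h) fun j _ => hUW j) fun i =>
      Fin.cases (fun _ => (hUW i).symm) fun j h => hort i j fun hij => h (hij ▸ rfl)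
  · rw [← (finSuccEquiv n).symm.iSup_comp, iSup_option]
    simp only [finSuccEquiv_symm_none, finSuccEquiv_symm_some, Fin.cons_zero, Fin.cons_succ, hsup]
    exact Submodule.sup_orthogonal_inf_of_hasOrthogonalProjection hUV

/-- Expand the square: normality gives `‖ϑ† x‖ = |z| ‖w‖`, and `ϑ w = z x` makes the cross term
`|z|² ‖x‖²`. -/
theorem norm_adjoint_sub_sq (hϑ : IsNormal ϑ) {x w : H} {z : ℂ} (hx : ϑ x = conj z • w)
    (hw : ϑ w = z • x) :
    ‖adjoint ϑ x - z • w‖ ^ 2 = 2 * ‖z‖ ^ 2 * (‖w‖ ^ 2 - ‖x‖ ^ 2) := by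
  have hinner : ⟪adjoint ϑ x, z • w⟫_ℂ = ((‖z‖ ^ 2 * ‖x‖ ^ 2 : ℝ) : ℂ) := by
    rw [← inner_conj_symm, inner_smul_left, inner_adjoint, hw, inner_smul_right,
      inner_self_eq_norm_sq_to_K, ← mul_assoc, mul_comm (conj z), Complex.mul_conj,
      Complex.normSq_eq_norm_sq]
    simp
  rw [@norm_sub_sq ℂ, hinner, norm_adjoint_apply hϑ, hx, norm_smul, norm_smul,
    RCLike.norm_conj]
  simp only [RCLike.re_to_complex, Complex.ofReal_re]
  ring

/-- The hypotheses are symmetric under `(x, w, z) ↦ (w, x, z*)`, so the preceding identity shows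
both `‖w‖² - ‖x‖²` and its negative to be nonnegative. -/
theorem norm_eq_of_exchange (hϑ : IsNormal ϑ) {x w : H} {z : ℂ} (hz : z ≠ 0)
    (hx : ϑ x = conj z • w) (hw : ϑ w = z • x) : ‖w‖ = ‖x‖ := by
  have h1 := norm_adjoint_sub_sq hϑ hx hw
  have h2 := norm_adjoint_sub_sq hϑ (z := conj z) (by simpa using hw) hx
  rw [RCLike.norm_conj] at h2
  have hz' : 0 < 2 * ‖z‖ ^ 2 := by positivity
  have h3 := nonneg_of_mul_nonneg_right (h1 ▸ sq_nonneg _) hz'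
  have h4 := nonneg_of_mul_nonneg_right (h2 ▸ sq_nonneg _) hz'
  exact (sq_eq_sq₀ (norm_nonneg _) (norm_nonneg _)).mp (by linarith)

/-- Equal norms force `ϑ† x = z w`; then `⟪x, ϑ† x⟫ = ⟪x, ϑ x⟫` reads `z ⟪x, w⟫ = z* ⟪x, w⟫`. -/
theorem inner_eq_zero_of_exchange (hϑ : IsNormal ϑ) {x w : H} {z : ℂ} (hz : z ≠ conj z)
    (hx : ϑ x = conj z • w) (hw : ϑ w = z • x) : ⟪x, w⟫_ℂ = 0 := by
  have hz0 : z ≠ 0 := by rintro rfl; simp at hz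
  have h := norm_adjoint_sub_sq hϑ hx hw
  rw [norm_eq_of_exchange hϑ hz0 hx hw, sub_self, mul_zero, sq_eq_zero_iff, norm_eq_zero,
    sub_eq_zero] at h
  have hi := inner_adjoint ϑ x x
  rw [h, hx, inner_smul_right, inner_smul_right] at hi
  by_contra h0
  exact hz (mul_right_cancel₀ h0 hi)

theorem IsInvariant.exists_sq_eigenvector {W : Submodule ℂ H} (hW : IsInvariant ϑ W)
    (h0 : W ≠ ⊥) : ∃ (z : ℂ) (x : H), x ∈ W ∧ ‖x‖ = 1 ∧ ϑ (ϑ x) = z ^ 2 • x := by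
  have : Nontrivial W := Submodule.nontrivial_iff_ne_bot.mpr h0
  obtain ⟨a, ha⟩ := Module.End.exists_eigenvalue
    ((ϑ.comp ϑ : H →ₗ[ℂ] H).restrict fun x hx => hW _ (hW x hx))
  obtain ⟨x, hx⟩ := ha.exists_hasEigenvector
  obtain ⟨z, rfl⟩ := IsAlgClosed.exists_pow_nat_eq a (n := 2) two_pos
  have hx0 : (x : H) ≠ 0 := by simpa using hx.2
  have hxe : ϑ (ϑ x) = z ^ 2 • (x : H) := congrArg Subtype.val hx.apply_eq_smul
  refine ⟨z, ((‖(x : H)‖⁻¹ : ℝ) : ℂ) • (x : H), W.smul_mem _ x.2, ?_, ?_⟩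
  · rw [norm_smul, Complex.norm_real, norm_inv, norm_norm, inv_mul_cancel₀ (by simpa using hx0)]
  · rw [map_smulₛₗ, map_smulₛₗ, hxe, Complex.conj_conj, smul_comm]

theorem IsMinimalInvariant.of_nonreal (hϑ : IsNormal ϑ) {W : Submodule ℂ H}
    (hW : IsMinimalInvariant ϑ W) {z : ℂ} {x : H} (hz : z ≠ conj z) (hxW : x ∈ W)
    (hx : ‖x‖ = 1) (h : ϑ (ϑ x) = z ^ 2 • x) :
    Module.finrank ℂ W = 2 ∧ ∃ (z : ℂ) (φ' φ'' : H), z ≠ conj z ∧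
      Orthonormal ℂ ![φ', φ''] ∧ W = Submodule.span ℂ {φ', φ''} ∧
      ϑ φ' = conj z • φ'' ∧ ϑ φ'' = z • φ' ∧
      W ≤ sqEigenspace ϑ z ⊔ sqEigenspace ϑ (conj z) := by
  have hz0 : z ≠ 0 := by rintro rfl; simp at hz
  have hz0' : conj z ≠ 0 := by simpa using hz0
  obtain ⟨w, hxw⟩ : ∃ w, ϑ x = conj z • w := ⟨(conj z)⁻¹ • ϑ x, by rw [smul_inv_smul₀ hz0']⟩
  have hwx : ϑ w = z • x := by
    rw [hxw, map_smulₛₗ, Complex.conj_conj, sq, mul_smul] at h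
    exact smul_right_injective H hz0 h
  have hon : Orthonormal ℂ ![x, w] := by
    rw [orthonormal_vecCons_iff]
    refine ⟨hx, by simpa using inner_eq_zero_of_exchange hϑ hz hxw hwx, ?_⟩
    simpa [orthonormal_iff_ite, Complex.ext_iff, inner_self_eq_norm_sq_to_K]
      using (norm_eq_of_exchange hϑ hz0 hxw hwx).trans hx
  have hwW : w ∈ W := by
    have := W.smul_mem (conj z)⁻¹ (hxw ▸ hW.2.1 x hxW)
    rwa [inv_smul_smul₀ hz0'] at this
  have hinv : IsInvariant ϑ (Submodule.span ℂ {x, w}) := isInvariant_span fun y hy => by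
    rcases hy with rfl | rfl
    · exact hxw ▸ Submodule.smul_mem _ _ (Submodule.subset_span (by simp))
    · exact hwx ▸ Submodule.smul_mem _ _ (Submodule.subset_span (by simp))
  have hspan : W = Submodule.span ℂ {x, w} :=
    hW.eq_of_mem hinv (Submodule.span_le.mpr (Set.pair_subset hxW hwW))
      (Submodule.subset_span (by simp)) (norm_ne_zero_iff.mp (hx ▸ one_ne_zero))
  refine ⟨?_, z, x, w, hz, hon, hspan, hxw, hwx, ?_⟩
  · have := finrank_span_eq_card hon.linearIndependent
    rwa [Matrix.range_cons, Matrix.range_cons, Matrix.range_empty, Set.union_empty,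
      Set.singleton_union, ← hspan, Fintype.card_fin] at this
  · rw [hspan, Submodule.span_le]
    refine Set.pair_subset (Submodule.mem_sup_left h) (Submodule.mem_sup_right ?_)
    change ϑ (ϑ w) = conj z ^ 2 • w
    rw [hwx, map_smulₛₗ, hxw, smul_smul, sq]

theorem IsMinimalInvariant.classification (hϑ : IsNormal ϑ) {W : Submodule ℂ H}
    (hW : IsMinimalInvariant ϑ W) :
    (Module.finrank ℂ W = 1 ∧ ∃ (z : ℂ) (φ : H), z = conj z ∧ φ ≠ 0 ∧ ϑ φ = z • φ ∧
      W = Submodule.span ℂ {φ} ∧ W ≤ sqEigenspace ϑ z) ∨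
    (Module.finrank ℂ W = 2 ∧ ∃ (z : ℂ) (φ' φ'' : H), z ≠ conj z ∧
      Orthonormal ℂ ![φ', φ''] ∧ W = Submodule.span ℂ {φ', φ''} ∧
      ϑ φ' = conj z • φ'' ∧ ϑ φ'' = z • φ' ∧
      W ≤ sqEigenspace ϑ z ⊔ sqEigenspace ϑ (conj z)) := by
  obtain ⟨z, x, hxW, hx, h⟩ := hW.2.1.exists_sq_eigenvector hW.1
  by_cases hz : z = conj z
  · left
    by_cases h0 : ϑ x + z • x = 0
    · refine hW.of_eigenvector (z := -z) (by rw [map_neg, ← hz]) hxW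
        (norm_ne_zero_iff.mp (hx ▸ one_ne_zero)) ?_
      rw [neg_smul, eq_neg_of_add_eq_zero_left h0]
    -- For real `z`, `ϑ (ϑ x + z x) = z² x + z ϑ x = z (ϑ x + z x)`.
    · refine hW.of_eigenvector hz (W.add_mem (hW.2.1 x hxW) (W.smul_mem z hxW)) h0 ?_
      rw [map_add, map_smulₛₗ, ← hz, h, smul_add, smul_smul, sq, add_comm]
  · exact Or.inr (hW.of_nonreal hϑ hz hxW hx h)

end AntilinearOp

theorem mainTheorem2 {H : Type*} [NormedAddCommGroup H] [InnerProductSpace ℂ H]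
    [FiniteDimensional ℂ H] (ϑ : H →ₗ⋆[ℂ] H) (hϑ : AntilinearOp.IsNormal ϑ) :
    (∀ W : Submodule ℂ H, AntilinearOp.IsInvariant ϑ W →
      AntilinearOp.IsInvariant (AntilinearOp.adjoint ϑ) W) ∧
    (∃ (n : ℕ) (W : Fin n → Submodule ℂ H),
      (∀ i, AntilinearOp.IsMinimalInvariant ϑ (W i)) ∧
      (∀ i j, i ≠ j → W i ⟂ W j) ∧
      (⨆ i, W i) = ⊤) ∧
    (∀ W : Submodule ℂ H, AntilinearOp.IsMinimalInvariant ϑ W →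
      (Module.finrank ℂ W = 1 ∧
        ∃ (z : ℂ) (φ : H), z = conj z ∧ φ ≠ 0 ∧ ϑ φ = z • φ ∧
          W = Submodule.span ℂ {φ} ∧ W ≤ AntilinearOp.sqEigenspace ϑ z) ∨
      (Module.finrank ℂ W = 2 ∧
        ∃ (z : ℂ) (φ' φ'' : H), z ≠ conj z ∧
          Orthonormal ℂ ![φ', φ''] ∧ W = Submodule.span ℂ {φ', φ''} ∧
          ϑ φ' = conj z • φ'' ∧ ϑ φ'' = z • φ' ∧
          W ≤ AntilinearOp.sqEigenspace ϑ z ⊔ AntilinearOp.sqEigenspace ϑ (conj z))) := by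
  refine ⟨fun W hW => hW.adjoint hϑ, ?_, fun W hW => hW.classification hϑ⟩
  exact AntilinearOp.IsInvariant.exists_orthogonal_decomposition hϑ ⊤ fun _ _ => trivial
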